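/- Let $G$ be a finite non-abelian group with center $Z(G)$. The commuting graph $\Gamma_G$ has vertex set $G\setminus Z(G)$, and two distinct vertices are adjacent iff they commute. For a finite simple graph $\mathcal G$ with vertex set $V$, let $CN(\mathcal G)$ be the real matrix indexed by $V$ with zero diagonal whose $(u,v)$ entry for $u\ne v$ is the number of vertices adjacent to both $u$ and $v$; let $CNRS(\mathcal G)$ be the diagonal matrix of the row sums of $CN(\mathcal G)$; and let $CNL(\mathcal G)=CNRS(\mathcal G)-CN(\mathcal G)$ and $CNSL(\mathcal G)=CNRS(\mathcal G)+CN(\mathcal G)$. The CNL-spectrum and the CNSL-spectrum of $\mathcal G$ are the multisets of eigenvalues of these two matrices, counted with multiplicity. With $\Delta_{\mathcal G}=\operatorname{tr}(CNRS(\mathcal G))/|V|$, the CNL-energy is $LE_{CN}(\mathcal G)=\sum_{\alpha}|\alpha-\Delta_{\mathcal G}|$ over the CNL-spectrum, and the CNSL-energy is $LE^+_{CN}(\mathcal G)=\sum_{\beta}|\beta-\Delta_{\mathcal G}|$ over the CNSL-spectrum. Below, $x^{k}$ inside a spectrum means that $x$ occurs $k$ times, and multiplicities are added when listed values coincide; $lK_m$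 is the disjoint union of $l$ complete graphs on $m$ vertices. **Proposition.** Let $q>2$ be a prime power and let $\Gamma=\Gamma_{GL(2,q)}$ be the commuting graph of the group of invertible $2\times 2$ matrices over the field with $q$ elements. Then 1. $\Gamma\cong\frac{q(q+1)}{2}K_{q^2-3q+2}\sqcup\frac{q(q-1)}{2}K_{q^2-q}\sqcup(q+1)K_{q^2-2q+1}$. 2. The CNL-spectrum of $\Gamma$ is $$\Big\{0^{\,q^2+q+1},\ \big((q^2-3q+2)(q^2-3q)\big)^{\frac12(q^2+q)(q^2-3q+1)},\ \big((q^2-q)(q^2-q-2)\big)^{\frac12(q^2-q)(q^2-q-1)},\ \big((q^2-2q+1)(q^2-2q-1)\big)^{(q+1)(q^2-2q)}\Big\}.$$ 3. The CNSL-spectrum of $\Gamma$ is $$\Big\{\big(2(q^2-3q+1)(q^2-3q)\big)^{\frac12(q^2+q)},\ \big((q^2-3q)^2\big)^{\frac12(q^2+q)(q^2-3q+1)},\ \big(2(q^2-q-1)(q^2-q-2)\big)^{\frac12(q^2-q)},$$ $$\big((q^2-q-2)^2\big)^{\frac12(q^2-q)(q^2-q-1)},\ \big(2(q^2-2q)(q^2-2q-1)\big)^{q+1},\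 \big((q^2-2q-1)^2\big)^{(q+1)(q^2-2q)}\Big\}.$$ 4. The CNL-energy of $\Gamma$ is $$LE_{CN}(\Gamma)=\frac{(q-2)(q-1)q^4(q+1)(2q-3)\big((q-1)q-1\big)}{q^3-q-1}.$$ 5. The CNSL-energy of $\Gamma$ is $$LE^+_{CN}(\Gamma)=\begin{cases}\dfrac{(q-2)q(q+1)\big(q(q(q(q(2q((q-4)q+6)-7)-7)-1)+11)+2\big)}{q^3-q-1},& q\le 5,\\[2ex]\dfrac{q(q+1)\big((q(q(q(q(2q-11)+20)-16)+7)+8)q^3-12q-4\big)}{q^3-q-1},& q\ge 6.\end{cases}$$ -/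

import Mathlib

namespace CommonNeighborhood

/-- The commuting graph of a group `G`: the vertices are the non-central elements of `G`, and two
distinct vertices are adjacent when they commute. -/
def commutingGraph (G : Type*) [Group G] : SimpleGraph {x : G // x ∉ Subgroup.center G} where
  Adj x y := x ≠ y ∧ (x : G) * y = y * x
  symm := ⟨fun _ _ h => ⟨h.1.symm, h.2.symm⟩⟩
  loopless := ⟨fun _ h => h.1 rfl⟩

/-- The disjoint union of `l` copies of the complete graph on `m` vertices. -/
def completeCopies (l m : ℕ) : SimpleGraph (Fin l × Fin m) where
  Adj x y := x.1 = y.1 ∧ x.2 ≠ y.2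
  symm := ⟨fun _ _ h => ⟨h.1.symm, h.2.symm⟩⟩
  loopless := ⟨fun _ h => h.2 rfl⟩

noncomputable section

variable {V : Type*} [Fintype V] [DecidableEq V]

/-- The common neighborhood matrix. Its off-diagonal entries count the common neighbors of two
vertices; its diagonal is zero. -/
def CN (Γ : SimpleGraph V) : Matrix V V ℝ :=
  Matrix.of fun i j => if i = j then 0 else ((Γ.commonNeighbors i j).ncard : ℝ)

/-- The diagonal matrix of the row sums of the common neighborhood matrix. -/
def CNRS (Γ : SimpleGraph V) : Matrix V V ℝ :=
  Matrix.diagonal fun i => ∑ k, CN Γ i k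

/-- The common neighborhood Laplacian matrix. -/
def CNL (Γ : SimpleGraph V) : Matrix V V ℝ := CNRS Γ - CN Γ

/-- The common neighborhood signless Laplacian matrix. -/
def CNSL (Γ : SimpleGraph V) : Matrix V V ℝ := CNRS Γ + CN Γ

/-- The CNL-spectrum: the eigenvalues of the (real symmetric) matrix `CNL Γ`, with
multiplicities. -/
def cnlSpec (Γ : SimpleGraph V) : Multiset ℝ := (CNL Γ).charpoly.roots

/-- The CNSL-spectrum: the eigenvalues of the (real symmetric) matrix `CNSL Γ`, with
multiplicities. -/
def cnslSpec (Γ : SimpleGraph V) : Multiset ℝ := (CNSL Γ).charpoly.roots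

/-- The average `tr(CNRS(Γ)) / |V(Γ)|`. -/
def cnAverage (Γ : SimpleGraph V) : ℝ := (CNRS Γ).trace / (Fintype.card V : ℝ)

/-- The CNL-energy: the sum of `|α - tr(CNRS(Γ)) / |V(Γ)||` over the CNL-spectrum. -/
def cnlEnergy (Γ : SimpleGraph V) : ℝ :=
  ((cnlSpec Γ).map fun α => |α - cnAverage Γ|).sum

/-- The CNSL-energy: the sum of `|β - tr(CNRS(Γ)) / |V(Γ)||` over the CNSL-spectrum. -/
def cnslEnergy (Γ : SimpleGraph V) : ℝ :=
  ((cnslSpec Γ).map fun β => |β - cnAverage Γ|).sum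

end

end CommonNeighborhood

open CommonNeighborhood

/-! The centralizer of a non-central `g` in GL(2, F) consists of the invertible elements `u g + v`
of the commutative algebra F[g]. Hence commuting is transitive on non-central elements, and the
graph is a disjoint union of cliques (`GL_two_mul_comm_trans`). The clique of `g` is the set of `u
(g - t)` with `u ≠ 0` and `t` not an eigenvalue, so it has (q - 1)(q - k) elements, where k ≤ 2 is
the number of eigenvalues of `g` in F (`card_commSetoid_class`). Double counting against eigenvalues
gives the number of elements with k = 1 and k = 2, and the order of the group gives the rest
(`card_noncentral_of_card_eigs`).

On a clique of size m, CN is (m - 2)(J - I) with J the all-ones matrix, and every row sum is (m -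
1)(m - 2). So CNRS + ε CN is a scalar plus a constant matrix, which yields both spectra at once
(`roots_cnSigned_completeCopies`).

For the energies one must know on which side of the average each eigenvalue lies. For q ≥ 3 every
sign is constant except that of 2(q² - 3q + 1)(q² - 3q), which changes between q = 5 and q = 6;
hence the two cases of the CNSL-energy. -/

namespace CommonNeighborhood

open Matrix Polynomial

/-! ### Spectra of disjoint unions of equal cliques. -/

section Spectrum

variable {V W : Type*} [Fintype V] [DecidableEq V] [Fintype W] [DecidableEq W]

/-- The matrix `CNRS Γ + ε CN Γ`, which is `CNL Γ` for `ε = -1` and `CNSL Γ` for `ε = 1`. -/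
noncomputable def cnSigned (ε : ℝ) (Γ : SimpleGraph V) : Matrix V V ℝ := CNRS Γ + ε • CN Γ

lemma CNL_eq_cnSigned (Γ : SimpleGraph V) : CNL Γ = cnSigned (-1) Γ := by
  simp [CNL, cnSigned, sub_eq_add_neg]

lemma CNSL_eq_cnSigned (Γ : SimpleGraph V) : CNSL Γ = cnSigned 1 Γ := by
  simp [CNSL, cnSigned]

omit [Fintype V] [Fintype W] in
lemma CN_iso_apply {G : SimpleGraph V} {H : SimpleGraph W} (e : G ≃g H) (i j : V) :
    CN H (e i) (e j) = CN G i j := by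
  have h : H.commonNeighbors (e i) (e j) = e '' G.commonNeighbors i j := by
    ext w
    obtain ⟨v, rfl⟩ := e.surjective w
    simp [SimpleGraph.mem_commonNeighbors, e.map_adj_iff]
  simp [CN, h, Set.ncard_image_of_injective _ e.injective]

omit [Fintype V] [Fintype W] in
lemma CN_iso {G : SimpleGraph V} {H : SimpleGraph W} (e : G ≃g H) :
    CN H = reindex e.toEquiv e.toEquiv (CN G) := by
  ext i j
  obtain ⟨i, rfl⟩ := e.surjective i
  obtain ⟨j, rfl⟩ := e.surjective j
  rw [CN_iso_apply]
  change _ = CN G (e.symm (e i)) (e.symm (e j))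
  rw [e.symm_apply_apply, e.symm_apply_apply]

lemma CNRS_iso {G : SimpleGraph V} {H : SimpleGraph W} (e : G ≃g H) :
    CNRS H = reindex e.toEquiv e.toEquiv (CNRS G) := by
  have h : (fun i => ∑ k, CN H i k) = (fun i => ∑ k, CN G i k) ∘ e.symm := by
    ext i
    obtain ⟨i, rfl⟩ := e.surjective i
    rw [← e.toEquiv.sum_comp]
    simp [CN_iso_apply]
  rw [CNRS, h, CNRS, reindex_apply, submatrix_diagonal_equiv]
  rfl

lemma charpoly_cnSigned_iso (ε : ℝ) {G : SimpleGraph V} {H : SimpleGraph W} (e : G ≃g H) :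
    (cnSigned ε H).charpoly = (cnSigned ε G).charpoly := by
  have h : cnSigned ε H = reindex e.toEquiv e.toEquiv (cnSigned ε G) := by
    rw [cnSigned, CN_iso e, CNRS_iso e]
    rfl
  rw [h, charpoly_reindex]

lemma trace_CNRS_iso {G : SimpleGraph V} {H : SimpleGraph W} (e : G ≃g H) :
    (CNRS H).trace = (CNRS G).trace := by
  rw [CNRS_iso e]
  exact e.symm.toEquiv.sum_comp fun i => CNRS G i i

omit [Fintype V] [Fintype W] in
lemma CN_sum (G : SimpleGraph V) (H : SimpleGraph W) :
    CN (G ⊕g H) = fromBlocks (CN G) 0 0 (CN H) := by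
  ext i j
  rcases i with i | i <;> rcases j with j | j
  · have h : (G ⊕g H).commonNeighbors (.inl i) (.inl j) = Sum.inl '' G.commonNeighbors i j := by
      ext (w | w) <;> simp [SimpleGraph.mem_commonNeighbors]
    simp [CN, h, Set.ncard_image_of_injective _ Sum.inl_injective]
  · have h : (G ⊕g H).commonNeighbors (.inl i) (.inr j) = ∅ := by
      ext (w | w) <;> simp [SimpleGraph.mem_commonNeighbors]
    simp [CN, h]
  · have h : (G ⊕g H).commonNeighbors (.inr i) (.inl j) = ∅ := by
      ext (w | w) <;> simp [SimpleGraph.mem_commonNeighbors]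
    simp [CN, h]
  · have h : (G ⊕g H).commonNeighbors (.inr i) (.inr j) = Sum.inr '' H.commonNeighbors i j := by
      ext (w | w) <;> simp [SimpleGraph.mem_commonNeighbors]
    simp [CN, h, Set.ncard_image_of_injective _ Sum.inr_injective]

lemma CNRS_sum (G : SimpleGraph V) (H : SimpleGraph W) :
    CNRS (G ⊕g H) = fromBlocks (CNRS G) 0 0 (CNRS H) := by
  rw [CNRS, CNRS, CNRS, fromBlocks_diagonal, CN_sum]
  congr 1
  ext (i | i) <;> simp

lemma charpoly_cnSigned_sum (ε : ℝ) (G : SimpleGraph V) (H : SimpleGraph W) :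
    (cnSigned ε (G ⊕g H)).charpoly = (cnSigned ε G).charpoly * (cnSigned ε H).charpoly := by
  rw [cnSigned, CN_sum, CNRS_sum, fromBlocks_smul, fromBlocks_add, smul_zero, add_zero, smul_zero,
    add_zero, charpoly_fromBlocks_zero₁₂]
  rfl

lemma trace_CNRS_sum (G : SimpleGraph V) (H : SimpleGraph W) :
    (CNRS (G ⊕g H)).trace = (CNRS G).trace + (CNRS H).trace := by
  simp [CNRS_sum, trace, Fintype.sum_sum_type]

/-- Two vertices of one clique have all its other vertices as common neighbors. The real number `m -
2` is negative for `m = 1`, but it is only reached when two distinct indices exist. -/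
lemma CN_completeCopies (l m : ℕ) (p q : Fin l × Fin m) :
    CN (completeCopies l m) p q =
      if p.1 = q.1 then (if p.2 = q.2 then 0 else ((m : ℝ) - 2)) else 0 := by
  obtain ⟨a, i⟩ := p
  obtain ⟨b, j⟩ := q
  by_cases hab : a = b
  · subst hab
    by_cases hij : i = j
    · simp [CN, hij]
    · have h : (completeCopies l m).commonNeighbors (a, i) (a, j) =
          (((Finset.univ \ {i, j} : Finset (Fin m)).image (Prod.mk a) :
            Finset (Fin l × Fin m)) : Set (Fin l × Fin m)) := by
        ext ⟨c, k⟩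
        simp only [SimpleGraph.mem_commonNeighbors, completeCopies, Finset.coe_image, Set.mem_image,
          Finset.mem_coe, Finset.mem_sdiff, Finset.mem_univ, Finset.mem_insert,
          Finset.mem_singleton, true_and, Prod.mk.injEq, not_or]
        constructor
        · rintro ⟨⟨rfl, h1⟩, -, h2⟩
          exact ⟨k, ⟨Ne.symm h1, Ne.symm h2⟩, rfl, rfl⟩
        · rintro ⟨k, ⟨h1, h2⟩, rfl, rfl⟩
          exact ⟨⟨rfl, Ne.symm h1⟩, rfl, Ne.symm h2⟩
      have hc : ({i, j} : Finset (Fin m)).card = 2 := Finset.card_pair hij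
      have hm : 2 ≤ m := by
        simpa [hc] using Finset.card_le_univ ({i, j} : Finset (Fin m))
      simp only [CN, of_apply, Prod.mk.injEq, true_and, hij, if_false, if_true, h,
        Set.ncard_coe_finset]
      rw [Finset.card_image_of_injective _ (Prod.mk_right_injective a),
        Finset.card_sdiff_of_subset (Finset.subset_univ _), hc]
      simp [Nat.cast_sub hm]
  · have h : (completeCopies l m).commonNeighbors (a, i) (b, j) = ∅ := by
      ext ⟨c, k⟩
      simp only [SimpleGraph.mem_commonNeighbors, completeCopies, Set.mem_empty_iff_false,
        iff_false, not_and]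
      rintro ⟨rfl, -⟩ h2
      exact absurd h2.symm hab
    simp [CN, h, hab]

lemma sum_CN_completeCopies (l m : ℕ) (p : Fin l × Fin m) :
    ∑ q, CN (completeCopies l m) p q = ((m : ℝ) - 1) * (m - 2) := by
  have hm : 1 ≤ m := p.2.pos
  simp_rw [CN_completeCopies, Fintype.sum_prod_type]
  rw [Finset.sum_eq_single p.1 (by intro b _ hb; simp [Ne.symm hb]) (by simp)]
  have : ∀ i : Fin m, (if p.2 = i then (0 : ℝ) else (m : ℝ) - 2) =
      ((m : ℝ) - 2) - if p.2 = i then (m : ℝ) - 2 else 0 := by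
    intro i; split_ifs <;> simp
  simp only [if_true, this, Finset.sum_sub_distrib, Finset.sum_ite_eq, Finset.mem_univ]
  simp
  ring

lemma trace_CNRS_completeCopies (l m : ℕ) :
    (CNRS (completeCopies l m)).trace = l * m * ((m - 1) * (m - 2)) := by
  simp [CNRS, trace_diagonal, sum_CN_completeCopies]

/-- The constant matrix has rank at most one and trace `m * b`, which determines its characteristic
polynomial; adding a scalar matrix translates the variable. -/
lemma charpoly_scalar_add_const (m : ℕ) (hm : 1 ≤ m) (a b : ℝ) :
    (scalar (Fin m) a + of fun _ _ => b).charpoly =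
      (X - C (a + m * b)) * (X - C a) ^ (m - 1) := by
  have h1 : scalar (Fin m) a + (of fun _ _ => b) =
      vecMulVec (fun _ => b) (fun _ => 1) - scalar (Fin m) (-a) := by
    ext i j
    by_cases h : i = j <;> simp [vecMulVec_apply, h, add_comm]
  have h2 : (fun _ : Fin m => b) ⬝ᵥ (fun _ => 1) = m * b := by simp [dotProduct]
  rw [h1, charpoly_sub_scalar, charpoly_vecMulVec, h2]
  obtain ⟨k, rfl⟩ : ∃ k, m = k + 1 := ⟨m - 1, by omega⟩
  simp only [Fintype.card_fin, Nat.add_sub_cancel, sub_comp, pow_comp, X_comp, map_neg,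
    smul_eq_C_mul, map_add, mul_comp, C_comp]
  ring

/-- With the coordinates swapped, the matrix is block diagonal with `l` equal blocks, each a scalar
plus the constant `ε (m - 2)`. The scalar is the row sum minus that constant, because CN vanishes on
the diagonal. -/
lemma charpoly_cnSigned_completeCopies (ε : ℝ) (l m : ℕ) (hm : 1 ≤ m) :
    (cnSigned ε (completeCopies l m)).charpoly =
      ((X - C (((m : ℝ) - 1) * (m - 2) * (1 + ε))) *
        (X - C (((m : ℝ) - 2) * (m - 1 - ε))) ^ (m - 1)) ^ l := by
  have h : cnSigned ε (completeCopies l m) = reindex (Equiv.prodComm _ _) (Equiv.prodComm _ _)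
      (blockDiagonal fun _ : Fin l =>
        scalar (Fin m) (((m : ℝ) - 2) * (m - 1 - ε)) + of fun _ _ => ε * ((m : ℝ) - 2)) := by
    ext ⟨a, i⟩ ⟨b, j⟩
    simp only [cnSigned, CNRS, sum_CN_completeCopies]
    simp only [Matrix.add_apply, Matrix.smul_apply, CN_completeCopies,
      diagonal_apply, reindex_apply, submatrix_apply, Equiv.prodComm_symm, Equiv.prodComm_apply,
      Prod.swap_prod_mk, blockDiagonal_apply, scalar_apply, of_apply, Prod.mk.injEq, smul_eq_mul]
    by_cases hab : a = b <;> by_cases hij : i = j <;> simp [hab, hij]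
    ring
  rw [h, charpoly_reindex, charpoly]
  have h2 (M : Matrix (Fin m) (Fin m) ℝ) : charmatrix (blockDiagonal fun _ : Fin l => M) =
      blockDiagonal fun _ : Fin l => charmatrix M := by
    ext ⟨i, a⟩ ⟨j, b⟩
    simp only [charmatrix_apply, blockDiagonal_apply, diagonal_apply, Prod.mk.injEq]
    by_cases hab : a = b <;> by_cases hij : i = j <;> simp [hab, hij]
  rw [h2, det_blockDiagonal]
  simp only [← charpoly.eq_1, charpoly_scalar_add_const m hm, Finset.prod_const, Finset.card_univ,
    Fintype.card_fin]
  congr 4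
  ring_nf

lemma roots_cnSigned_completeCopies (ε : ℝ) (l m : ℕ) (hm : 1 ≤ m) :
    (cnSigned ε (completeCopies l m)).charpoly.roots =
      Multiset.replicate l (((m : ℝ) - 1) * (m - 2) * (1 + ε)) +
      Multiset.replicate (l * (m - 1)) (((m : ℝ) - 2) * (m - 1 - ε)) := by
  rw [charpoly_cnSigned_completeCopies ε l m hm, roots_pow, roots_mul, roots_pow, roots_X_sub_C,
    roots_X_sub_C, nsmul_add, Multiset.nsmul_singleton, Multiset.nsmul_singleton,
    Multiset.nsmul_replicate]
  exact mul_ne_zero (X_sub_C_ne_zero _) (pow_ne_zero _ (X_sub_C_ne_zero _))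

lemma roots_cnSigned_sum (ε : ℝ) (G : SimpleGraph V) (H : SimpleGraph W) :
    (cnSigned ε (G ⊕g H)).charpoly.roots =
      (cnSigned ε G).charpoly.roots + (cnSigned ε H).charpoly.roots := by
  rw [charpoly_cnSigned_sum, roots_mul]
  exact mul_ne_zero (charpoly_monic _).ne_zero (charpoly_monic _).ne_zero

end Spectrum

/-! ### Spectrum, average and energy for three families of cliques. -/

section ThreeFamilies

variable {V : Type*} [Fintype V] [DecidableEq V] {Γ : SimpleGraph V} {l₁ m₁ l₂ m₂ l₃ m₃ : ℕ}

lemma roots_cnSigned_of_iso (ε : ℝ) (h₁ : 1 ≤ m₁) (h₂ : 1 ≤ m₂) (h₃ : 1 ≤ m₃)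
    (e : Γ ≃g (completeCopies l₁ m₁ ⊕g completeCopies l₂ m₂ ⊕g completeCopies l₃ m₃)) :
    (cnSigned ε Γ).charpoly.roots =
      Multiset.replicate l₁ (((m₁ : ℝ) - 1) * (m₁ - 2) * (1 + ε)) +
      Multiset.replicate (l₁ * (m₁ - 1)) (((m₁ : ℝ) - 2) * (m₁ - 1 - ε)) +
      (Multiset.replicate l₂ (((m₂ : ℝ) - 1) * (m₂ - 2) * (1 + ε)) +
      Multiset.replicate (l₂ * (m₂ - 1)) (((m₂ : ℝ) - 2) * (m₂ - 1 - ε))) +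
      (Multiset.replicate l₃ (((m₃ : ℝ) - 1) * (m₃ - 2) * (1 + ε)) +
      Multiset.replicate (l₃ * (m₃ - 1)) (((m₃ : ℝ) - 2) * (m₃ - 1 - ε))) := by
  rw [← charpoly_cnSigned_iso ε e, roots_cnSigned_sum, roots_cnSigned_sum,
    roots_cnSigned_completeCopies ε _ _ h₁, roots_cnSigned_completeCopies ε _ _ h₂,
    roots_cnSigned_completeCopies ε _ _ h₃]

lemma cnAverage_of_iso
    (e : Γ ≃g (completeCopies l₁ m₁ ⊕g completeCopies l₂ m₂ ⊕g completeCopies l₃ m₃)) :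
    cnAverage Γ = (l₁ * m₁ * ((m₁ - 1) * (m₁ - 2)) + l₂ * m₂ * ((m₂ - 1) * (m₂ - 2)) +
      l₃ * m₃ * ((m₃ - 1) * (m₃ - 2))) / (l₁ * m₁ + l₂ * m₂ + l₃ * m₃ : ℝ) := by
  rw [cnAverage, ← trace_CNRS_iso e, Fintype.card_congr e.toEquiv, trace_CNRS_sum, trace_CNRS_sum]
  simp [trace_CNRS_completeCopies]

lemma sum_abs_roots_cnSigned_of_iso (ε δ : ℝ) (h₁ : 1 ≤ m₁) (h₂ : 1 ≤ m₂) (h₃ : 1 ≤ m₃)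
    (e : Γ ≃g (completeCopies l₁ m₁ ⊕g completeCopies l₂ m₂ ⊕g completeCopies l₃ m₃)) :
    ((cnSigned ε Γ).charpoly.roots.map fun x => |x - δ|).sum =
      l₁ * |((m₁ : ℝ) - 1) * (m₁ - 2) * (1 + ε) - δ| +
      l₁ * ((m₁ : ℝ) - 1) * |((m₁ : ℝ) - 2) * (m₁ - 1 - ε) - δ| +
      (l₂ * |((m₂ : ℝ) - 1) * (m₂ - 2) * (1 + ε) - δ| +
      l₂ * ((m₂ : ℝ) - 1) * |((m₂ : ℝ) - 2) * (m₂ - 1 - ε) - δ|) +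
      (l₃ * |((m₃ : ℝ) - 1) * (m₃ - 2) * (1 + ε) - δ| +
      l₃ * ((m₃ : ℝ) - 1) * |((m₃ : ℝ) - 2) * (m₃ - 1 - ε) - δ|) := by
  rw [roots_cnSigned_of_iso ε h₁ h₂ h₃ e]
  simp only [Multiset.map_add, Multiset.map_replicate, Multiset.sum_add, Multiset.sum_replicate,
    nsmul_eq_mul, Nat.cast_mul, Nat.cast_sub h₁, Nat.cast_sub h₂, Nat.cast_sub h₃, Nat.cast_one]

end ThreeFamilies

/-! ### Position of each eigenvalue relative to the average. -/

section Estimates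

/-- The average of the row sums of the common neighborhood matrix of the commuting graph of
`GL (Fin 2) F` for a field `F` with `x` elements. -/
noncomputable def glAverage (x : ℝ) : ℝ :=
  (x ^ 7 - 4 * x ^ 6 + 3 * x ^ 5 + 4 * x ^ 4 - 3 * x ^ 3 - x ^ 2 - 2 * x) / (x ^ 3 - x - 1)

variable {x : ℝ}

/-- The method of this and the following estimates: after clearing the denominator and shifting the
variable to start at 0, all coefficients of the difference are nonnegative. -/
lemma cube_sub_pos (hx : 3 ≤ x) : 0 < x ^ 3 - x - 1 := by
  obtain ⟨y, hy, rfl⟩ : ∃ y, 0 ≤ y ∧ x = y + 3 := ⟨x - 3, by linarith, by ring⟩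
  ring_nf
  positivity

lemma glAverage_mul (hx : 3 ≤ x) : glAverage x * (x ^ 3 - x - 1) =
    x ^ 7 - 4 * x ^ 6 + 3 * x ^ 5 + 4 * x ^ 4 - 3 * x ^ 3 - x ^ 2 - 2 * x :=
  div_mul_cancel₀ _ (cube_sub_pos hx).ne'

lemma glAverage_le (hx : 3 ≤ x) {a : ℝ} (h : x ^ 7 - 4 * x ^ 6 + 3 * x ^ 5 + 4 * x ^ 4 - 3 * x ^ 3
    - x ^ 2 - 2 * x ≤ a * (x ^ 3 - x - 1)) : glAverage x ≤ a :=
  (div_le_iff₀ (cube_sub_pos hx)).2 h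

lemma le_glAverage (hx : 3 ≤ x) {a : ℝ} (h : a * (x ^ 3 - x - 1) ≤
    x ^ 7 - 4 * x ^ 6 + 3 * x ^ 5 + 4 * x ^ 4 - 3 * x ^ 3 - x ^ 2 - 2 * x) : a ≤ glAverage x :=
  (le_div_iff₀ (cube_sub_pos hx)).2 h

lemma glAverage_nonneg (hx : 3 ≤ x) : 0 ≤ glAverage x := by
  refine le_glAverage hx ?_
  obtain ⟨y, hy, rfl⟩ : ∃ y, 0 ≤ y ∧ x = y + 3 := ⟨x - 3, by linarith, by ring⟩
  rw [← sub_nonneg]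
  ring_nf
  positivity

/-- Split, double and nonsplit refer to cliques of elements with two, one and no eigenvalues in F.
With m the clique size, "eigenvalue" is the CNL value m(m - 2), "sq" the CNSL value (m - 2)², and
"row" the CNSL value 2(m - 1)(m - 2) of the all-ones vector. -/
lemma split_eigenvalue_le (hx : 3 ≤ x) :
    (x ^ 2 - 3 * x + 2) * (x ^ 2 - 3 * x) ≤ glAverage x := by
  refine le_glAverage hx ?_
  obtain ⟨y, hy, rfl⟩ : ∃ y, 0 ≤ y ∧ x = y + 3 := ⟨x - 3, by linarith, by ring⟩
  rw [← sub_nonneg]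
  ring_nf
  positivity

lemma split_sq_le (hx : 3 ≤ x) : (x ^ 2 - 3 * x) ^ 2 ≤ glAverage x := by
  refine le_glAverage hx ?_
  obtain ⟨y, hy, rfl⟩ : ∃ y, 0 ≤ y ∧ x = y + 3 := ⟨x - 3, by linarith, by ring⟩
  rw [← sub_nonneg]
  ring_nf
  positivity

/-- The one comparison that fails at 3, 4 and 5, hence the shift by 6. -/
lemma le_split_row (hx : 6 ≤ x) :
    glAverage x ≤ 2 * (x ^ 2 - 3 * x + 1) * (x ^ 2 - 3 * x) := by
  refine glAverage_le (by linarith) ?_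
  obtain ⟨y, hy, rfl⟩ : ∃ y, 0 ≤ y ∧ x = y + 6 := ⟨x - 6, by linarith, by ring⟩
  rw [← sub_nonneg]
  ring_nf
  positivity

lemma le_nonsplit_eigenvalue (hx : 3 ≤ x) :
    glAverage x ≤ (x ^ 2 - x) * (x ^ 2 - x - 2) := by
  refine glAverage_le hx ?_
  obtain ⟨y, hy, rfl⟩ : ∃ y, 0 ≤ y ∧ x = y + 3 := ⟨x - 3, by linarith, by ring⟩
  rw [← sub_nonneg]
  ring_nf
  positivity

lemma le_nonsplit_sq (hx : 3 ≤ x) : glAverage x ≤ (x ^ 2 - x - 2) ^ 2 := by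
  refine glAverage_le hx ?_
  obtain ⟨y, hy, rfl⟩ : ∃ y, 0 ≤ y ∧ x = y + 3 := ⟨x - 3, by linarith, by ring⟩
  rw [← sub_nonneg]
  ring_nf
  positivity

lemma le_nonsplit_row (hx : 3 ≤ x) :
    glAverage x ≤ 2 * (x ^ 2 - x - 1) * (x ^ 2 - x - 2) := by
  refine glAverage_le hx ?_
  obtain ⟨y, hy, rfl⟩ : ∃ y, 0 ≤ y ∧ x = y + 3 := ⟨x - 3, by linarith, by ring⟩
  rw [← sub_nonneg]
  ring_nf
  positivity

lemma double_eigenvalue_le (hx : 3 ≤ x) :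
    (x ^ 2 - 2 * x + 1) * (x ^ 2 - 2 * x - 1) ≤ glAverage x := by
  refine le_glAverage hx ?_
  obtain ⟨y, hy, rfl⟩ : ∃ y, 0 ≤ y ∧ x = y + 3 := ⟨x - 3, by linarith, by ring⟩
  rw [← sub_nonneg]
  ring_nf
  positivity

lemma double_sq_le (hx : 3 ≤ x) : (x ^ 2 - 2 * x - 1) ^ 2 ≤ glAverage x := by
  refine le_glAverage hx ?_
  obtain ⟨y, hy, rfl⟩ : ∃ y, 0 ≤ y ∧ x = y + 3 := ⟨x - 3, by linarith, by ring⟩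
  rw [← sub_nonneg]
  ring_nf
  positivity

lemma le_double_row (hx : 3 ≤ x) :
    glAverage x ≤ 2 * (x ^ 2 - 2 * x) * (x ^ 2 - 2 * x - 1) := by
  refine glAverage_le hx ?_
  obtain ⟨y, hy, rfl⟩ : ∃ y, 0 ≤ y ∧ x = y + 3 := ⟨x - 3, by linarith, by ring⟩
  rw [← sub_nonneg]
  ring_nf
  positivity

end Estimates

/-! ### Explicit spectra and energies for the clique sizes of GL(2, q). -/

section Energies

variable {V : Type*} [Fintype V] [DecidableEq V] {Γ : SimpleGraph V} {q : ℕ}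

lemma two_mul_half_mul_succ (q : ℕ) : 2 * (q * (q + 1) / 2) = q ^ 2 + q := by
  rw [Nat.mul_div_cancel' (Nat.even_mul_succ_self q).two_dvd]
  ring

lemma two_mul_half_mul_pred (q : ℕ) : 2 * (q * (q - 1) / 2) + q = q ^ 2 := by
  rw [Nat.mul_div_cancel' (Nat.even_mul_pred_self q).two_dvd]
  cases q
  · rfl
  · simp; ring

lemma cast_half_mul_succ (q : ℕ) : ((q * (q + 1) / 2 : ℕ) : ℝ) = ((q : ℝ) ^ 2 + q) / 2 := by
  have : (2 * (q * (q + 1) / 2 : ℕ) : ℝ) = (q : ℝ) ^ 2 + q := by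
    exact_mod_cast two_mul_half_mul_succ q
  linarith

lemma cast_half_mul_pred (q : ℕ) : ((q * (q - 1) / 2 : ℕ) : ℝ) = ((q : ℝ) ^ 2 - q) / 2 := by
  have : (2 * (q * (q - 1) / 2 : ℕ) + q : ℝ) = (q : ℝ) ^ 2 := by
    exact_mod_cast two_mul_half_mul_pred q
  linarith

/-- The additive form shows that the truncated subtraction is exact, so that the size can be cast to
ℝ. -/
lemma split_size_add (hq : 2 < q) : q ^ 2 - 3 * q + 2 + 3 * q = q ^ 2 + 2 := by
  have : 3 * q ≤ q ^ 2 := by nlinarith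
  omega

lemma nonsplit_size_add (hq : 2 < q) : q ^ 2 - q + q = q ^ 2 := by
  have : q ≤ q ^ 2 := by nlinarith
  omega

lemma double_size_add (hq : 2 < q) : q ^ 2 - 2 * q + 1 + 2 * q = q ^ 2 + 1 := by
  have : 2 * q ≤ q ^ 2 := by nlinarith
  omega

lemma cast_split_size (hq : 2 < q) :
    ((q ^ 2 - 3 * q + 2 : ℕ) : ℝ) = (q : ℝ) ^ 2 - 3 * q + 2 := by
  have : ((q ^ 2 - 3 * q + 2 : ℕ) + 3 * q : ℝ) = (q : ℝ) ^ 2 + 2 := by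
    exact_mod_cast split_size_add hq
  linarith

lemma cast_nonsplit_size (hq : 2 < q) : ((q ^ 2 - q : ℕ) : ℝ) = (q : ℝ) ^ 2 - q := by
  have : ((q ^ 2 - q : ℕ) + q : ℝ) = (q : ℝ) ^ 2 := by
    exact_mod_cast nonsplit_size_add hq
  linarith

lemma cast_double_size (hq : 2 < q) :
    ((q ^ 2 - 2 * q + 1 : ℕ) : ℝ) = (q : ℝ) ^ 2 - 2 * q + 1 := by
  have : ((q ^ 2 - 2 * q + 1 : ℕ) + 2 * q : ℝ) = (q : ℝ) ^ 2 + 1 := by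
    exact_mod_cast double_size_add hq
  linarith

lemma three_mul_le_sq (hq : 2 < q) : 3 * q ≤ q ^ 2 := by nlinarith

lemma cnAverage_of_GL_iso (hq : 2 < q)
    (e : Γ ≃g (completeCopies (q * (q + 1) / 2) (q ^ 2 - 3 * q + 2) ⊕g
        completeCopies (q * (q - 1) / 2) (q ^ 2 - q) ⊕g
        completeCopies (q + 1) (q ^ 2 - 2 * q + 1))) :
    cnAverage Γ = glAverage q := by
  rw [cnAverage_of_iso e, cast_half_mul_succ, cast_half_mul_pred, cast_split_size hq,
    cast_nonsplit_size hq, cast_double_size hq, glAverage, Nat.cast_add, Nat.cast_one]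
  have hx : (3 : ℝ) ≤ q := by exact_mod_cast hq
  have hd := cube_sub_pos hx
  generalize (q : ℝ) = x at *
  -- The number of vertices, |GL(2, q)| - (q - 1). Its factor x - 1 cancels against the trace,
  -- leaving the denominator x³ - x - 1.
  have hN : (x ^ 2 + x) / 2 * (x ^ 2 - 3 * x + 2) + (x ^ 2 - x) / 2 * (x ^ 2 - x) +
      (x + 1) * (x ^ 2 - 2 * x + 1) = (x - 1) * (x ^ 3 - x - 1) := by ring
  have hx1 : x - 1 ≠ 0 := by linarith
  rw [hN, div_eq_div_iff (mul_ne_zero hx1 hd.ne') hd.ne']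
  ring

lemma half_mul_succ_mul (q : ℕ) : q * (q + 1) / 2 * (q ^ 2 - 3 * q + 2 - 1) =
    (q ^ 2 + q) * (q ^ 2 - 3 * q + 1) / 2 := by
  rw [← two_mul_half_mul_succ, mul_assoc, Nat.mul_div_cancel_left _ two_pos]
  rfl

lemma half_mul_pred_mul (q : ℕ) : q * (q - 1) / 2 * (q ^ 2 - q - 1) =
    (q ^ 2 - q) * (q ^ 2 - q - 1) / 2 := by
  have h : q ^ 2 - q = 2 * (q * (q - 1) / 2) := by
    have := two_mul_half_mul_pred q
    omega
  conv_rhs => rw [h, mul_assoc, Nat.mul_div_cancel_left _ two_pos, ← h]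

/-- The number of cliques: each contributes one 0 to the CNL-spectrum, through its all-ones vector.
-/
lemma card_classes (q : ℕ) :
    q * (q + 1) / 2 + q * (q - 1) / 2 + (q + 1) = q ^ 2 + q + 1 := by
  have := two_mul_half_mul_succ q
  have := two_mul_half_mul_pred q
  omega

lemma cnlSpec_of_GL_iso (hq : 2 < q)
    (e : Γ ≃g (completeCopies (q * (q + 1) / 2) (q ^ 2 - 3 * q + 2) ⊕g
        completeCopies (q * (q - 1) / 2) (q ^ 2 - q) ⊕g
        completeCopies (q + 1) (q ^ 2 - 2 * q + 1))) :
    cnlSpec Γ = Multiset.replicate (q ^ 2 + q + 1) (0 : ℝ) +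
      Multiset.replicate ((q ^ 2 + q) * (q ^ 2 - 3 * q + 1) / 2)
        (((q : ℝ) ^ 2 - 3 * q + 2) * ((q : ℝ) ^ 2 - 3 * q)) +
      Multiset.replicate ((q ^ 2 - q) * (q ^ 2 - q - 1) / 2)
        (((q : ℝ) ^ 2 - q) * ((q : ℝ) ^ 2 - q - 2)) +
      Multiset.replicate ((q + 1) * (q ^ 2 - 2 * q))
        (((q : ℝ) ^ 2 - 2 * q + 1) * ((q : ℝ) ^ 2 - 2 * q - 1)) := by
  have h3 := three_mul_le_sq hq
  rw [cnlSpec, CNL_eq_cnSigned, roots_cnSigned_of_iso (-1) (by omega) (by omega) (by omega) e,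
    half_mul_succ_mul, half_mul_pred_mul, Nat.add_sub_cancel, cast_split_size hq,
    cast_nonsplit_size hq, cast_double_size hq, ← card_classes,
    Multiset.replicate_add (_ + _) (q + 1), Multiset.replicate_add (q * (q + 1) / 2)]
  have e0 (x : ℝ) : x * (1 + -1) = 0 := by ring
  have e1 (x : ℝ) : (x ^ 2 - 3 * x + 2 - 2) * (x ^ 2 - 3 * x + 2 - 1 - -1) =
    (x ^ 2 - 3 * x + 2) * (x ^ 2 - 3 * x) := by ring
  have e2 (x : ℝ) : (x ^ 2 - x - 2) * (x ^ 2 - x - 1 - -1) = (x ^ 2 - x) * (x ^ 2 - x - 2) := by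
    ring
  have e3 (x : ℝ) : (x ^ 2 - 2 * x + 1 - 2) * (x ^ 2 - 2 * x + 1 - 1 - -1) =
    (x ^ 2 - 2 * x + 1) * (x ^ 2 - 2 * x - 1) := by ring
  rw [e0, e0, e0, e1, e2, e3]
  ac_rfl

lemma cnslSpec_of_GL_iso (hq : 2 < q)
    (e : Γ ≃g (completeCopies (q * (q + 1) / 2) (q ^ 2 - 3 * q + 2) ⊕g
        completeCopies (q * (q - 1) / 2) (q ^ 2 - q) ⊕g
        completeCopies (q + 1) (q ^ 2 - 2 * q + 1))) :
    cnslSpec Γ = Multiset.replicate ((q ^ 2 + q) / 2)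
        (2 * ((q : ℝ) ^ 2 - 3 * q + 1) * ((q : ℝ) ^ 2 - 3 * q)) +
      Multiset.replicate ((q ^ 2 + q) * (q ^ 2 - 3 * q + 1) / 2)
        (((q : ℝ) ^ 2 - 3 * q) ^ 2) +
      Multiset.replicate ((q ^ 2 - q) / 2)
        (2 * ((q : ℝ) ^ 2 - q - 1) * ((q : ℝ) ^ 2 - q - 2)) +
      Multiset.replicate ((q ^ 2 - q) * (q ^ 2 - q - 1) / 2)
        (((q : ℝ) ^ 2 - q - 2) ^ 2) +
      Multiset.replicate (q + 1)
        (2 * ((q : ℝ) ^ 2 - 2 * q) * ((q : ℝ) ^ 2 - 2 * q - 1)) +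
      Multiset.replicate ((q + 1) * (q ^ 2 - 2 * q))
        (((q : ℝ) ^ 2 - 2 * q - 1) ^ 2) := by
  have h3 := three_mul_le_sq hq
  have h1 : (q ^ 2 + q) / 2 = q * (q + 1) / 2 := by
    have := two_mul_half_mul_succ q
    omega
  have h2 : (q ^ 2 - q) / 2 = q * (q - 1) / 2 := by
    have := two_mul_half_mul_pred q
    omega
  rw [cnslSpec, CNSL_eq_cnSigned, roots_cnSigned_of_iso 1 (by omega) (by omega) (by omega) e,
    half_mul_succ_mul, half_mul_pred_mul, Nat.add_sub_cancel, cast_split_size hq,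
    cast_nonsplit_size hq, cast_double_size hq, h1, h2]
  have e1 (x : ℝ) : (x ^ 2 - 3 * x + 2 - 1) * (x ^ 2 - 3 * x + 2 - 2) * (1 + 1) =
    2 * (x ^ 2 - 3 * x + 1) * (x ^ 2 - 3 * x) := by ring
  have e2 (x : ℝ) : (x ^ 2 - 3 * x + 2 - 2) * (x ^ 2 - 3 * x + 2 - 1 - 1) =
    (x ^ 2 - 3 * x) ^ 2 := by ring
  have e3 (x : ℝ) : (x ^ 2 - x - 1) * (x ^ 2 - x - 2) * (1 + 1) =
    2 * (x ^ 2 - x - 1) * (x ^ 2 - x - 2) := by ring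
  have e4 (x : ℝ) : (x ^ 2 - x - 2) * (x ^ 2 - x - 1 - 1) = (x ^ 2 - x - 2) ^ 2 := by ring
  have e5 (x : ℝ) : (x ^ 2 - 2 * x + 1 - 1) * (x ^ 2 - 2 * x + 1 - 2) * (1 + 1) =
    2 * (x ^ 2 - 2 * x) * (x ^ 2 - 2 * x - 1) := by ring
  have e6 (x : ℝ) : (x ^ 2 - 2 * x + 1 - 2) * (x ^ 2 - 2 * x + 1 - 1 - 1) =
    (x ^ 2 - 2 * x - 1) ^ 2 := by ring
  rw [e1, e2, e3, e4, e5, e6]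
  ac_rfl

lemma cnlEnergy_of_GL_iso (hq : 2 < q)
    (e : Γ ≃g (completeCopies (q * (q + 1) / 2) (q ^ 2 - 3 * q + 2) ⊕g
        completeCopies (q * (q - 1) / 2) (q ^ 2 - q) ⊕g
        completeCopies (q + 1) (q ^ 2 - 2 * q + 1))) :
    cnlEnergy Γ = ((q : ℝ) - 2) * (q - 1) * q ^ 4 * (q + 1) * (2 * q - 3) * ((q - 1) * q - 1) /
        ((q : ℝ) ^ 3 - q - 1) := by
  have h3 := three_mul_le_sq hq
  rw [cnlEnergy, cnAverage_of_GL_iso hq e, cnlSpec, CNL_eq_cnSigned,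
    sum_abs_roots_cnSigned_of_iso (-1) _ (by omega) (by omega) (by omega) e, cast_half_mul_succ,
    cast_half_mul_pred, cast_split_size hq, cast_nonsplit_size hq, cast_double_size hq,
    Nat.cast_add, Nat.cast_one]
  have hx : (3 : ℝ) ≤ q := by exact_mod_cast hq
  have hd := cube_sub_pos hx
  generalize (q : ℝ) = x at *
  rw [abs_of_nonpos (by linarith [glAverage_nonneg hx]),
    abs_of_nonpos (by linarith [split_eigenvalue_le hx]),
    abs_of_nonpos (by linarith [glAverage_nonneg hx]),
    abs_of_nonneg (by linarith [le_nonsplit_eigenvalue hx]),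
    abs_of_nonpos (by linarith [glAverage_nonneg hx]),
    abs_of_nonpos (by linarith [double_eigenvalue_le hx]), eq_div_iff hd.ne']
  have hG := glAverage_mul hx
  -- With the signs fixed, the energy is linear in the average; the multiplier is its coefficient,
  -- the multiplicities counted positively below the average and negatively above.
  linear_combination ((x ^ 2 + x) / 2 + (x ^ 2 + x) / 2 * (x ^ 2 - 3 * x + 1) + (x ^ 2 - x) / 2 -
    (x ^ 2 - x) / 2 * (x ^ 2 - x - 1) + (x + 1) + (x + 1) * (x ^ 2 - 2 * x)) * hG

/-- The remaining absolute value is the only one whose sign depends on q. -/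
lemma cnslEnergy_of_GL_iso (hq : 2 < q)
    (e : Γ ≃g (completeCopies (q * (q + 1) / 2) (q ^ 2 - 3 * q + 2) ⊕g
        completeCopies (q * (q - 1) / 2) (q ^ 2 - q) ⊕g
        completeCopies (q + 1) (q ^ 2 - 2 * q + 1))) :
    cnslEnergy Γ = ((q : ℝ) ^ 2 + q) / 2 *
        |2 * ((q : ℝ) ^ 2 - 3 * q + 1) * (q ^ 2 - 3 * q) - glAverage q| +
      ((q : ℝ) ^ 2 + q) / 2 * (q ^ 2 - 3 * q + 1) * (glAverage q - (q ^ 2 - 3 * q) ^ 2) +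
      ((q : ℝ) ^ 2 - q) / 2 * (2 * (q ^ 2 - q - 1) * (q ^ 2 - q - 2) - glAverage q) +
      ((q : ℝ) ^ 2 - q) / 2 * (q ^ 2 - q - 1) * ((q ^ 2 - q - 2) ^ 2 - glAverage q) +
      ((q : ℝ) + 1) * (2 * (q ^ 2 - 2 * q) * (q ^ 2 - 2 * q - 1) - glAverage q) +
      ((q : ℝ) + 1) * (q ^ 2 - 2 * q) * (glAverage q - (q ^ 2 - 2 * q - 1) ^ 2) := by
  have h3 := three_mul_le_sq hq
  rw [cnslEnergy, cnAverage_of_GL_iso hq e, cnslSpec, CNSL_eq_cnSigned,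
    sum_abs_roots_cnSigned_of_iso 1 _ (by omega) (by omega) (by omega) e, cast_half_mul_succ,
    cast_half_mul_pred, cast_split_size hq, cast_nonsplit_size hq, cast_double_size hq,
    Nat.cast_add, Nat.cast_one]
  have hx : (3 : ℝ) ≤ q := by exact_mod_cast hq
  generalize (q : ℝ) = x at *
  have h0 : (x ^ 2 - 3 * x + 2 - 1) * (x ^ 2 - 3 * x + 2 - 2) * (1 + 1) =
    2 * (x ^ 2 - 3 * x + 1) * (x ^ 2 - 3 * x) := by ring
  rw [h0]
  generalize |2 * (x ^ 2 - 3 * x + 1) * (x ^ 2 - 3 * x) - glAverage x| = r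
  rw [abs_of_nonpos (by linarith [split_sq_le hx]),
    abs_of_nonneg (by linarith [le_nonsplit_row hx]),
    abs_of_nonneg (by linarith [le_nonsplit_sq hx]),
    abs_of_nonneg (by linarith [le_double_row hx]),
    abs_of_nonpos (by linarith [double_sq_le hx])]
  ring

lemma cnslEnergy_of_GL_iso_of_le (hq : 2 < q) (hq5 : q ≤ 5)
    (e : Γ ≃g (completeCopies (q * (q + 1) / 2) (q ^ 2 - 3 * q + 2) ⊕g
        completeCopies (q * (q - 1) / 2) (q ^ 2 - q) ⊕g
        completeCopies (q + 1) (q ^ 2 - 2 * q + 1))) :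
    cnslEnergy Γ = ((q : ℝ) - 2) * q * (q + 1) *
          (q * (q * (q * (q * (2 * q * ((q - 4) * q + 6) - 7) - 7) - 1) + 11) + 2) /
        ((q : ℝ) ^ 3 - q - 1) := by
  have hx : (3 : ℝ) ≤ q := by exact_mod_cast hq
  have hd := cube_sub_pos hx
  have h : 2 * ((q : ℝ) ^ 2 - 3 * q + 1) * (q ^ 2 - 3 * q) ≤ glAverage q := by
    refine le_glAverage hx ?_
    clear e
    -- Only q = 3, 4, 5 occur, so the comparison is numerical.
    interval_cases q <;> norm_num
  rw [cnslEnergy_of_GL_iso hq e, abs_of_nonpos (by linarith), eq_div_iff hd.ne']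
  have hG := glAverage_mul hx
  linear_combination (((q : ℝ) ^ 2 + q) / 2 + ((q : ℝ) ^ 2 + q) / 2 * (q ^ 2 - 3 * q + 1) -
    ((q : ℝ) ^ 2 - q) / 2 - ((q : ℝ) ^ 2 - q) / 2 * (q ^ 2 - q - 1) - (q + 1) +
    (q + 1) * ((q : ℝ) ^ 2 - 2 * q)) * hG

lemma cnslEnergy_of_GL_iso_of_ge (hq6 : 6 ≤ q)
    (e : Γ ≃g (completeCopies (q * (q + 1) / 2) (q ^ 2 - 3 * q + 2) ⊕g
        completeCopies (q * (q - 1) / 2) (q ^ 2 - q) ⊕g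
        completeCopies (q + 1) (q ^ 2 - 2 * q + 1))) :
    cnslEnergy Γ = (q : ℝ) * (q + 1) *
          ((q * (q * (q * (q * (2 * q - 11) + 20) - 16) + 7) + 8) * q ^ 3 - 12 * q - 4) /
        ((q : ℝ) ^ 3 - q - 1) := by
  have hx : (6 : ℝ) ≤ q := by exact_mod_cast hq6
  have hd := cube_sub_pos (x := q) (by linarith)
  rw [cnslEnergy_of_GL_iso (by omega) e, abs_of_nonneg (by linarith [le_split_row hx]),
    eq_div_iff hd.ne']
  have hG := glAverage_mul (x := q) (by linarith)
  linear_combination (-((q : ℝ) ^ 2 + q) / 2 + ((q : ℝ) ^ 2 + q) / 2 * (q ^ 2 - 3 * q + 1) -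
    ((q : ℝ) ^ 2 - q) / 2 - ((q : ℝ) ^ 2 - q) / 2 * (q ^ 2 - q - 1) - (q + 1) +
    (q + 1) * ((q : ℝ) ^ 2 - 2 * q)) * hG

end Energies

/-! ### From an equivalence relation with known class sizes to a union of cliques. -/

section Classes

/-- Each class is identified with `Fin m`; counting then forces the quotient to have `l` elements.
-/
lemma exists_equiv_of_class_card {X : Type*} [Finite X] (s : Setoid X) {l m : ℕ} (hm : 0 < m)
    (hc : ∀ x, Nat.card {y // s x y} = m) (hX : Nat.card X = l * m) :
    ∃ e : X ≃ Fin l × Fin m, ∀ x y, (e x).1 = (e y).1 ↔ s x y := by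
  have hfib (c : Quotient s) : Nonempty ({x : X // Quotient.mk s x = c} ≃ Fin m) := by
    obtain ⟨x, rfl⟩ := Quotient.exists_rep c
    refine ⟨Finite.equivFinOfCardEq ?_⟩
    rw [← hc x]
    exact Nat.card_congr (Equiv.subtypeEquivRight fun y => Quotient.eq.trans ⟨s.symm, s.symm⟩)
  let E : X ≃ Quotient s × Fin m := (Equiv.sigmaFiberEquiv (Quotient.mk s)).symm.trans
    ((Equiv.sigmaCongrRight fun c => (hfib c).some).trans (Equiv.sigmaEquivProd _ _))
  have hQ : Nat.card (Quotient s) = l := by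
    have h := Nat.card_congr E
    rw [hX, Nat.card_prod, Nat.card_fin] at h
    exact (Nat.eq_of_mul_eq_mul_right hm h).symm
  refine ⟨E.trans ((Finite.equivFinOfCardEq hQ).prodCongr (Equiv.refl _)), fun x y => ?_⟩
  exact (Finite.equivFinOfCardEq hQ).injective.eq_iff.trans Quotient.eq

/-- The invariant `t` will be the number of eigenvalues. It is constant on classes and determines
their size, so each fiber of `t` is a family of equal cliques with no edges to the other fibers. -/
theorem iso_of_classes {V : Type*} [Finite V] (G : SimpleGraph V) (s : Setoid V)
    (hadj : ∀ x y, G.Adj x y ↔ x ≠ y ∧ s x y) (t : V → ℕ) (ht : ∀ x, t x ≤ 2)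
    (hts : ∀ x y, s x y → t x = t y) (l m : ℕ → ℕ) (hm : ∀ k ≤ 2, 0 < m k)
    (hc : ∀ x, Nat.card {y // s x y} = m (t x))
    (hN : ∀ k ≤ 2, Nat.card {x // t x = k} = l k * m k) :
    Nonempty (G ≃g (completeCopies (l 2) (m 2) ⊕g completeCopies (l 0) (m 0) ⊕g
      completeCopies (l 1) (m 1))) := by
  have hpiece (k : ℕ) (hk : k ≤ 2) : ∃ e : {x // t x = k} ≃ Fin (l k) × Fin (m k),
      ∀ x y, (e x).1 = (e y).1 ↔ s x.1 y.1 := by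
    refine exists_equiv_of_class_card (s.comap Subtype.val) (hm k hk) (fun x => ?_) (hN k hk)
    obtain ⟨x, rfl⟩ := x
    rw [← hc x]
    exact Nat.card_congr (Equiv.subtypeSubtypeEquivSubtype
      (p := fun y => t y = t x) (q := fun y => s x y) fun {y} h => (hts _ _ h).symm)
  obtain ⟨e₂, h₂⟩ := hpiece 2 le_rfl
  obtain ⟨e₀, h₀⟩ := hpiece 0 (by norm_num)
  obtain ⟨e₁, h₁⟩ := hpiece 1 (by norm_num)
  let f : ((Fin (l 2) × Fin (m 2)) ⊕ (Fin (l 0) × Fin (m 0))) ⊕ (Fin (l 1) × Fin (m 1)) → V :=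
    Sum.elim (Sum.elim (fun p => (e₂.symm p).1) fun p => (e₀.symm p).1) fun p => (e₁.symm p).1
  have hf : Function.Bijective f := by
    constructor
    · apply Function.Injective.sumElim
      · apply Function.Injective.sumElim
        · exact Subtype.val_injective.comp e₂.symm.injective
        · exact Subtype.val_injective.comp e₀.symm.injective
        · intro a b h
          have := congrArg t h
          rw [(e₂.symm a).2, (e₀.symm b).2] at this
          omega
      · exact Subtype.val_injective.comp e₁.symm.injective
      · rintro (a | a) b h
        · have := congrArg t h
          simp only [Sum.elim_inl] at this
          rw [(e₂.symm a).2, (e₁.symm b).2] at this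
          omega
        · have := congrArg t h
          simp only [Sum.elim_inr] at this
          rw [(e₀.symm a).2, (e₁.symm b).2] at this
          omega
    · intro x
      have hx := ht x
      interval_cases h : t x
      · exact ⟨.inl (.inr (e₀ ⟨x, h⟩)), by simp [f]⟩
      · exact ⟨.inr (e₁ ⟨x, h⟩), by simp [f]⟩
      · exact ⟨.inl (.inl (e₂ ⟨x, h⟩)), by simp [f]⟩
  have hadj_iff {k : ℕ} (e : {x // t x = k} ≃ Fin (l k) × Fin (m k))
      (he : ∀ x y, (e x).1 = (e y).1 ↔ s x.1 y.1) (p q : Fin (l k) × Fin (m k)) :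
      G.Adj (e.symm p).1 (e.symm q).1 ↔ (completeCopies (l k) (m k)).Adj p q := by
    rw [hadj, ← he, Ne, ← Subtype.ext_iff, e.symm.injective.eq_iff]
    simp only [Equiv.apply_symm_apply, completeCopies, Prod.ext_iff]
    tauto
  have hnadj {x y : V} (h : t x ≠ t y) : ¬ G.Adj x y := fun h' => h (hts _ _ ((hadj x y).1 h').2)
  refine ⟨(RelIso.symm ⟨Equiv.ofBijective f hf, ?_⟩)⟩
  rintro ((a | a) | a) ((b | b) | b)
  · simpa [f] using hadj_iff e₂ h₂ a b
  · simpa [f] using hnadj (by rw [(e₂.symm a).2, (e₀.symm b).2]; omega)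
  · simpa [f] using hnadj (by rw [(e₂.symm a).2, (e₁.symm b).2]; omega)
  · simpa [f] using hnadj (by rw [(e₀.symm a).2, (e₂.symm b).2]; omega)
  · simpa [f] using hadj_iff e₀ h₀ a b
  · simpa [f] using hnadj (by rw [(e₀.symm a).2, (e₁.symm b).2]; omega)
  · simpa [f] using hnadj (by rw [(e₁.symm a).2, (e₂.symm b).2]; omega)
  · simpa [f] using hnadj (by rw [(e₁.symm a).2, (e₀.symm b).2]; omega)
  · simpa [f] using hadj_iff e₁ h₁ a b

end Classes

/-! ### Centralizers in GL(2, F) and the sizes of the commuting classes. -/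

section Centralizer

open Matrix

variable {F : Type*} [Field F]

lemma mem_center_GL_two_iff {g : GL (Fin 2) F} :
    g ∈ Subgroup.center (GL (Fin 2) F) ↔ g.1 0 1 = 0 ∧ g.1 1 0 = 0 ∧ g.1 0 0 = g.1 1 1 := by
  rw [GeneralLinearGroup.mem_center_iff_val_mem_range_scalar]
  constructor
  · rintro ⟨a, ha⟩
    simp [← ha]
  · rintro ⟨h1, h2, h3⟩
    refine ⟨g.1 0 0, ?_⟩
    ext i j
    fin_cases i <;> fin_cases j <;> simp [h1, h2, h3]

/-- For matrices with rows (a, b), (c, d), commuting means that the vectors (b, c, a - d) are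
parallel: the three 2 × 2 minors vanish. -/
lemma GL_two_mul_comm_iff {g h : GL (Fin 2) F} : g * h = h * g ↔
    g.1 0 1 * h.1 1 0 = h.1 0 1 * g.1 1 0 ∧
    (g.1 0 0 - g.1 1 1) * h.1 0 1 = (h.1 0 0 - h.1 1 1) * g.1 0 1 ∧
    (g.1 0 0 - g.1 1 1) * h.1 1 0 = (h.1 0 0 - h.1 1 1) * g.1 1 0 := by
  rw [Units.ext_iff, Units.val_mul, Units.val_mul, ← Matrix.ext_iff]
  simp only [Fin.forall_fin_two, mul_apply, Fin.sum_univ_two]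
  constructor
  · rintro ⟨⟨h1, h2⟩, h3, h4⟩
    exact ⟨by linear_combination h1, by linear_combination h2, by linear_combination -h3⟩
  · rintro ⟨h1, h2, h3⟩
    exact ⟨⟨by linear_combination h1, by linear_combination h2⟩, by linear_combination -h3,
      by linear_combination -h1⟩

/-- For non-central `g` the vector (b, c, a - d) is nonzero, so that of `h` is a multiple of it; `u`
is the quotient at a nonzero coordinate. -/
lemma exists_eq_of_GL_two_mul_comm {g h : GL (Fin 2) F}
    (hg : g ∉ Subgroup.center (GL (Fin 2) F)) (hgh : g * h = h * g) :
    ∃ u v : F, h.1 0 0 = u * g.1 0 0 + v ∧ h.1 0 1 = u * g.1 0 1 ∧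
      h.1 1 0 = u * g.1 1 0 ∧ h.1 1 1 = u * g.1 1 1 + v := by
  obtain ⟨h1, h2, h3⟩ := GL_two_mul_comm_iff.1 hgh
  rw [mem_center_GL_two_iff] at hg
  have key (u : F) (e1 : h.1 0 1 = u * g.1 0 1) (e2 : h.1 1 0 = u * g.1 1 0)
      (e3 : h.1 0 0 - h.1 1 1 = u * (g.1 0 0 - g.1 1 1)) :
      ∃ u v : F, h.1 0 0 = u * g.1 0 0 + v ∧ h.1 0 1 = u * g.1 0 1 ∧
      h.1 1 0 = u * g.1 1 0 ∧ h.1 1 1 = u * g.1 1 1 + v :=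
    ⟨u, h.1 0 0 - u * g.1 0 0, by ring, e1, e2, by linear_combination -e3⟩
  by_cases hb : g.1 0 1 = 0
  · by_cases hc : g.1 1 0 = 0
    · have hd : g.1 0 0 - g.1 1 1 ≠ 0 := fun h => hg ⟨hb, hc, sub_eq_zero.1 h⟩
      refine key ((h.1 0 0 - h.1 1 1) / (g.1 0 0 - g.1 1 1)) ?_ ?_ ?_ <;> field_simp
      · linear_combination h2
      · linear_combination h3
    · refine key (h.1 1 0 / g.1 1 0) ?_ ?_ ?_ <;> field_simp
      · linear_combination -h1
      · linear_combination -h3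
  · refine key (h.1 0 1 / g.1 0 1) ?_ ?_ ?_ <;> field_simp
    · linear_combination h1
    · linear_combination -h2

/-- Both `g` and `k` are of the form `u h + v`, and such matrices commute with each other. -/
lemma GL_two_mul_comm_trans {g h k : GL (Fin 2) F} (hh : h ∉ Subgroup.center (GL (Fin 2) F))
    (hgh : g * h = h * g) (hhk : h * k = k * h) : g * k = k * g := by
  obtain ⟨u, v, h1, h2, h3, h4⟩ := exists_eq_of_GL_two_mul_comm hh hgh.symm
  obtain ⟨u', v', h1', h2', h3', h4'⟩ := exists_eq_of_GL_two_mul_comm hh hhk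
  rw [GL_two_mul_comm_iff, h1, h2, h3, h4, h1', h2', h3', h4']
  refine ⟨?_, ?_, ?_⟩ <;> ring

variable (F) in
/-- Commuting is an equivalence relation on the non-central elements of `GL (Fin 2) F`. -/
def commSetoid : Setoid {g : GL (Fin 2) F // g ∉ Subgroup.center (GL (Fin 2) F)} where
  r g h := (g : GL (Fin 2) F) * h = h * g
  iseqv := ⟨fun _ => rfl, fun h => h.symm, fun {_ y _} h h' => GL_two_mul_comm_trans y.2 h h'⟩

lemma det_GL_two_ne_zero (g : GL (Fin 2) F) :
    g.1 0 0 * g.1 1 1 - g.1 0 1 * g.1 1 0 ≠ 0 := by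
  rw [← det_fin_two]
  exact ((isUnit_iff_isUnit_det _).1 g.isUnit).ne_zero

variable [Fintype F] [DecidableEq F]

/-- The eigenvalues in `F` of an element of `GL (Fin 2) F`. -/
def eigs (g : GL (Fin 2) F) : Finset F :=
  {t | (t - g.1 0 0) * (t - g.1 1 1) = g.1 0 1 * g.1 1 0}

lemma mem_eigs {g : GL (Fin 2) F} {t : F} :
    t ∈ eigs g ↔ (t - g.1 0 0) * (t - g.1 1 1) = g.1 0 1 * g.1 1 0 := by
  simp [eigs]

lemma zero_notMem_eigs (g : GL (Fin 2) F) : 0 ∉ eigs g := by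
  rw [mem_eigs]
  intro h
  exact det_GL_two_ne_zero g (by linear_combination h)

/-- Two distinct elements of the field are the eigenvalues exactly when trace and determinant
match. -/
lemma mem_eigs_and_mem_eigs_iff {g : GL (Fin 2) F} {s t : F} (hst : s ≠ t) :
    s ∈ eigs g ∧ t ∈ eigs g ↔ s ∈ eigs g ∧ g.1 0 0 + g.1 1 1 = s + t := by
  rw [mem_eigs, mem_eigs]
  refine and_congr_right fun hs => ⟨fun ht => ?_, fun h => ?_⟩
  · have : (s - t) * (s + t - (g.1 0 0 + g.1 1 1)) = 0 := by linear_combination hs - ht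
    rcases mul_eq_zero.1 this with h | h
    · exact absurd (sub_eq_zero.1 h) hst
    · exact (sub_eq_zero.1 h).symm
  · linear_combination hs + (s - t) * h

lemma eigs_eq_singleton_iff {g : GL (Fin 2) F} {s : F} :
    eigs g = {s} ↔ s ∈ eigs g ∧ g.1 0 0 + g.1 1 1 = s + s := by
  constructor
  · intro h
    have hs : s ∈ eigs g := by simp [h]
    refine ⟨hs, ?_⟩
    -- The trace minus `s` is the other root of the characteristic polynomial.
    have ht : g.1 0 0 + g.1 1 1 - s ∈ eigs g := by
      rw [mem_eigs] at hs ⊢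
      linear_combination hs
    rw [h, Finset.mem_singleton] at ht
    linear_combination ht
  · rintro ⟨hs, h⟩
    ext t
    rw [Finset.mem_singleton]
    refine ⟨fun ht => ?_, fun e => e ▸ hs⟩
    by_contra hne
    have := ((mem_eigs_and_mem_eigs_iff (Ne.symm hne)).1 ⟨hs, ht⟩).2
    exact hne (by linear_combination h - this)

lemma card_eigs_le_two (g : GL (Fin 2) F) : (eigs g).card ≤ 2 := by
  by_cases h : ∃ s, s ∈ eigs g
  · obtain ⟨s, hs⟩ := h
    refine (Finset.card_le_card (t := {s, g.1 0 0 + g.1 1 1 - s}) fun t ht => ?_).trans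
      Finset.card_le_two
    rw [Finset.mem_insert, Finset.mem_singleton]
    by_cases hne : s = t
    · exact .inl hne.symm
    · exact .inr (by linear_combination -((mem_eigs_and_mem_eigs_iff hne).1 ⟨hs, ht⟩).2)
  · push Not at h
    rw [Finset.eq_empty_of_forall_notMem h]
    simp

/-- The element of the centralizer of `g` given by `u (g - t)`. -/
noncomputable def centralizerElement (g : {g : GL (Fin 2) F // g ∉ Subgroup.center (GL (Fin 2) F)})
    (p : {u : F // u ≠ 0} × {t : F // t ∉ eigs g.1}) :
    {h : {g : GL (Fin 2) F // g ∉ Subgroup.center (GL (Fin 2) F)} // commSetoid F g h} := by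
  refine ⟨⟨GeneralLinearGroup.mkOfDetNeZero
    !![p.1.1 * (g.1.1 0 0 - p.2.1), p.1.1 * g.1.1 0 1;
      p.1.1 * g.1.1 1 0, p.1.1 * (g.1.1 1 1 - p.2.1)] ?_, ?_⟩, ?_⟩
  · rw [det_fin_two_of]
    intro h
    apply p.2.2
    rw [mem_eigs]
    -- The determinant of `u (g - t)` is `u²` times the characteristic polynomial of `g` at `t`.
    have : p.1.1 * p.1.1 *
        ((p.2.1 - g.1.1 0 0) * (p.2.1 - g.1.1 1 1) - g.1.1 0 1 * g.1.1 1 0) = 0 := by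
      linear_combination h
    exact sub_eq_zero.1 ((mul_eq_zero.1 this).resolve_left (mul_ne_zero p.1.2 p.1.2))
  · rw [mem_center_GL_two_iff]
    have hg := g.2
    rw [mem_center_GL_two_iff] at hg
    simpa [GeneralLinearGroup.mkOfDetNeZero, p.1.2] using hg
  · change g.1 * _ = _ * g.1
    rw [GL_two_mul_comm_iff]
    simp only [GeneralLinearGroup.mkOfDetNeZero]
    simp
    refine ⟨?_, ?_, ?_⟩ <;> ring

lemma centralizerElement_bijective
    (g : {g : GL (Fin 2) F // g ∉ Subgroup.center (GL (Fin 2) F)}) :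
    Function.Bijective (centralizerElement g) := by
  have hg := g.2
  rw [mem_center_GL_two_iff] at hg
  constructor
  · rintro ⟨⟨u, hu⟩, ⟨t, ht⟩⟩ ⟨⟨u', hu'⟩, ⟨t', ht'⟩⟩ h
    have h' : (centralizerElement g (⟨u, hu⟩, ⟨t, ht⟩)).1.1.1 =
      (centralizerElement g (⟨u', hu'⟩, ⟨t', ht'⟩)).1.1.1 := by rw [h]
    have h00 := congrFun (congrFun h' 0) 0
    have h01 := congrFun (congrFun h' 0) 1
    have h10 := congrFun (congrFun h' 1) 0
    have h11 := congrFun (congrFun h' 1) 1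
    simp only [centralizerElement, GeneralLinearGroup.mkOfDetNeZero] at h00 h01 h10 h11
    simp at h00 h01 h10 h11
    have huu : u = u' := by
      by_contra hne
      apply hg
      refine ⟨h01.resolve_left hne, h10.resolve_left hne, ?_⟩
      have : (u - u') * (g.1.1 0 0 - g.1.1 1 1) = 0 := by linear_combination h00 - h11
      exact sub_eq_zero.1 ((mul_eq_zero.1 this).resolve_left (sub_ne_zero.2 hne))
    subst huu
    have htt : t = t' := by
      have : u * (t - t') = 0 := by linear_combination -h00
      exact sub_eq_zero.1 ((mul_eq_zero.1 this).resolve_left hu)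
    subst htt
    rfl
  · rintro ⟨⟨h, hh⟩, hgh⟩
    obtain ⟨u, v, h00, h01, h10, h11⟩ := exists_eq_of_GL_two_mul_comm (h := h) g.2 hgh
    have hu : u ≠ 0 := by
      rintro rfl
      apply hh
      rw [mem_center_GL_two_iff]
      simp [h00, h01, h10, h11]
    -- The witness comes from `u g + v = u (g - t)` with `t = -v / u`.
    have ht : -v / u ∉ eigs g.1 := by
      rw [mem_eigs]
      intro e
      apply det_GL_two_ne_zero h
      rw [h00, h01, h10, h11]
      field_simp at e
      linear_combination e
    refine ⟨(⟨u, hu⟩, ⟨-v / u, ht⟩), Subtype.ext (Subtype.ext (Units.ext ?_))⟩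
    ext i j
    fin_cases i <;> fin_cases j <;>
      simp [centralizerElement, GeneralLinearGroup.mkOfDetNeZero, h00, h01, h10, h11] <;>
      field_simp <;> ring

lemma card_commSetoid_class (g : {g : GL (Fin 2) F // g ∉ Subgroup.center (GL (Fin 2) F)}) :
    Nat.card {h // commSetoid F g h} =
      (Fintype.card F - 1) * (Fintype.card F - (eigs g.1).card) := by
  rw [← Nat.card_eq_of_bijective _ (centralizerElement_bijective g), Nat.card_prod,
    Nat.card_eq_fintype_card, Nat.card_eq_fintype_card, Fintype.card_subtype_compl,
    Fintype.card_subtype_compl]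
  simp

/-- Commuting elements share their class, and the class size (q - 1)(q - k) determines k, since k ≤
2 < q rules out truncation. -/
lemma card_eigs_eq_of_comm (hF : 2 < Fintype.card F)
    (g h : {g : GL (Fin 2) F // g ∉ Subgroup.center (GL (Fin 2) F)}) (hgh : commSetoid F g h) :
    (eigs g.1).card = (eigs h.1).card := by
  have e : Nat.card {k // commSetoid F g k} = Nat.card {k // commSetoid F h k} :=
    Nat.card_congr (Equiv.subtypeEquivRight fun k =>
      ⟨(commSetoid F).trans ((commSetoid F).symm hgh), (commSetoid F).trans hgh⟩)
  rw [card_commSetoid_class, card_commSetoid_class] at e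
  have h1 := Nat.eq_of_mul_eq_mul_left (by omega) e
  have := card_eigs_le_two g.1
  have := card_eigs_le_two h.1
  omega

end Centralizer

/-! ### Counting non-central elements by their number of eigenvalues. -/

section Counting

open Matrix Finset

variable {F : Type*} [Field F] [Fintype F] [DecidableEq F]

/-- The number of `2 × 2` matrices `!![a, b; c, s + t - a]` having `s` and `t` as eigenvalues. -/
lemma card_matrices_with_eigenvalues (s t : F) :
    #{p : F × F × F | (s - p.1) * (p.1 - t) = p.2.1 * p.2.2} =
      Fintype.card F * (Fintype.card F - 1) + #({s, t} : Finset F) * Fintype.card F := by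
  -- If `b ≠ 0` then `c` is determined; if `b = 0` then `c` is free when `a` is `s` or `t`, and
  -- there is no solution otherwise.
  have hc (a b : F) : #{c : F | (s - a) * (a - t) = b * c} =
      if b = 0 then (if a ∈ ({s, t} : Finset F) then Fintype.card F else 0) else 1 := by
    split_ifs with hb ha
    · have : (s - a) * (a - t) = 0 := by
        rcases mem_insert.1 ha with rfl | ha
        · simp
        · simp [mem_singleton.1 ha]
      simp [this, hb]
    · have : (s - a) * (a - t) ≠ 0 := by
        rw [mem_insert, mem_singleton, not_or] at ha
        exact mul_ne_zero (sub_ne_zero.2 (Ne.symm ha.1)) (sub_ne_zero.2 ha.2)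
      simp [this, hb]
    · rw [card_eq_one]
      refine ⟨(s - a) * (a - t) / b, ?_⟩
      ext c
      rw [mem_filter, mem_singleton, eq_div_iff hb, mul_comm c b, eq_comm]
      simp
  have hb (a : F) : #{p : F × F | (s - a) * (a - t) = p.1 * p.2} =
      (Fintype.card F - 1) + if a ∈ ({s, t} : Finset F) then Fintype.card F else 0 := by
    simp only [card_filter, Fintype.sum_prod_type] at hc ⊢
    simp only [hc]
    rw [sum_ite, sum_const, sum_const, filter_eq' univ (0 : F), filter_ne' univ (0 : F)]
    simp [add_comm]
  have : #{p : F × F × F | (s - p.1) * (p.1 - t) = p.2.1 * p.2.2} =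
      ∑ a : F, #{p : F × F | (s - a) * (a - t) = p.1 * p.2} := by
    simp only [card_filter, Fintype.sum_prod_type]
  rw [this]
  simp only [hb, sum_add_distrib, sum_const, ← sum_filter, filter_mem_eq_inter, univ_inter]
  simp

local notation "NC" => {g : GL (Fin 2) F // g ∉ Subgroup.center (GL (Fin 2) F)}

/-- The trace gives the last entry, so the element is the triple (a, b, c). Its determinant is `s *
t ≠ 0`, so invertibility is automatic and only scalars have to be excluded. -/
lemma card_noncentral_with_eigenvalues {s t : F} (hs : s ≠ 0) (ht : t ≠ 0) :
    #{g : NC | s ∈ eigs g.1 ∧ g.1.1 0 0 + g.1.1 1 1 = s + t} =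
      #{p : F × F × F | (s - p.1) * (p.1 - t) = p.2.1 * p.2.2 ∧
        ¬ (p.2.1 = 0 ∧ p.2.2 = 0 ∧ p.1 = s + t - p.1)} := by
  refine card_bij (fun g _ => (g.1.1 0 0, g.1.1 0 1, g.1.1 1 0)) ?_ ?_ ?_
  · rintro g hg
    simp only [mem_filter, mem_univ, true_and, mem_eigs] at hg ⊢
    have h := g.2
    rw [mem_center_GL_two_iff] at h
    have e : g.1.1 1 1 = s + t - g.1.1 0 0 := by linear_combination hg.2
    rw [e] at h hg
    exact ⟨by linear_combination hg.1, h⟩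
  · rintro g hg g' hg' h
    simp only [mem_filter, mem_univ, true_and, Prod.mk.injEq] at hg hg' h
    refine Subtype.ext (Units.ext ?_)
    ext i j
    fin_cases i <;> fin_cases j
    · exact h.1
    · exact h.2.1
    · exact h.2.2
    · change g.1.1 1 1 = g'.1.1 1 1
      linear_combination hg.2 - hg'.2 - h.1
  · rintro ⟨a, b, c⟩ h
    simp only [mem_filter, mem_univ, true_and] at h
    have hdet : det !![a, b; c, s + t - a] ≠ 0 := by
      rw [det_fin_two_of]
      have : a * (s + t - a) - b * c = s * t := by linear_combination h.1
      rw [this]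
      exact mul_ne_zero hs ht
    refine ⟨⟨GeneralLinearGroup.mkOfDetNeZero _ hdet, ?_⟩, ?_, ?_⟩
    · rw [mem_center_GL_two_iff]
      simpa [GeneralLinearGroup.mkOfDetNeZero] using h.2
    · simp only [mem_filter, mem_univ, true_and, mem_eigs]
      simp [GeneralLinearGroup.mkOfDetNeZero]
      linear_combination h.1
    · simp [GeneralLinearGroup.mkOfDetNeZero]

lemma card_noncentral_with_distinct_eigenvalues {s t : F} (hs : s ≠ 0) (ht : t ≠ 0)
    (hst : s ≠ t) : #{g : NC | s ∈ eigs g.1 ∧ t ∈ eigs g.1} =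
      Fintype.card F * (Fintype.card F + 1) := by
  simp only [mem_eigs_and_mem_eigs_iff hst]
  rw [card_noncentral_with_eigenvalues hs ht]
  have : #{p : F × F × F | (s - p.1) * (p.1 - t) = p.2.1 * p.2.2 ∧
      ¬ (p.2.1 = 0 ∧ p.2.2 = 0 ∧ p.1 = s + t - p.1)} =
      #{p : F × F × F | (s - p.1) * (p.1 - t) = p.2.1 * p.2.2} := by
    congr 1
    ext ⟨a, b, c⟩
    simp only [mem_filter, mem_univ, true_and, and_iff_left_iff_imp]
    rintro h ⟨rfl, rfl, ha⟩
    apply hst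
    -- A scalar matrix has a double eigenvalue, which contradicts `s ≠ t`.
    have h0 : (s - a) * (s - a) = 0 := by linear_combination h - (s - a) * ha
    have h1 := mul_self_eq_zero.1 h0
    linear_combination 2 * h1 + ha
  rw [this, card_matrices_with_eigenvalues, card_pair hst]
  obtain ⟨k, hk⟩ : ∃ k, Fintype.card F = k + 1 :=
    ⟨_, (Nat.succ_pred_eq_of_pos Fintype.card_pos).symm⟩
  rw [hk, Nat.add_sub_cancel]
  ring

lemma card_noncentral_with_double_eigenvalue {s : F} (hs : s ≠ 0) :
    #{g : NC | eigs g.1 = {s}} = Fintype.card F ^ 2 - 1 := by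
  simp only [eigs_eq_singleton_iff]
  rw [card_noncentral_with_eigenvalues hs hs]
  have : ({p : F × F × F | (s - p.1) * (p.1 - s) = p.2.1 * p.2.2 ∧
      ¬ (p.2.1 = 0 ∧ p.2.2 = 0 ∧ p.1 = s + s - p.1)} : Finset (F × F × F)) =
      ({p : F × F × F | (s - p.1) * (p.1 - s) = p.2.1 * p.2.2} : Finset (F × F × F)).erase
        (s, 0, 0) := by
    ext ⟨a, b, c⟩
    simp only [mem_filter, mem_univ, true_and, mem_erase, Ne, Prod.mk.injEq]
    rw [and_comm]
    refine and_congr_left fun h => not_congr ?_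
    constructor
    · rintro ⟨rfl, rfl, ha⟩
      refine ⟨?_, rfl, rfl⟩
      -- The trace condition `ha` says nothing about `a` in characteristic 2, so `a = s` is drawn
      -- from the quadratic equation.
      have h0 : (a - s) * (a - s) = 0 := by linear_combination -h
      exact sub_eq_zero.1 (mul_self_eq_zero.1 h0)
    · rintro ⟨rfl, rfl, rfl⟩
      simp
  rw [this, card_erase_of_mem (by simp), card_matrices_with_eigenvalues]
  obtain ⟨k, hk⟩ : ∃ k, Fintype.card F = k + 1 :=
    ⟨_, (Nat.succ_pred_eq_of_pos Fintype.card_pos).symm⟩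
  rw [hk, Nat.add_sub_cancel]
  simp
  ring_nf
  rw [add_assoc 1, Nat.add_sub_cancel_left]

/-- Double counting of pairs (g, s) with `eigs g = {s}`, over the q - 1 nonzero `s`. -/
lemma card_noncentral_of_card_eigs_eq_one :
    #{g : NC | #(eigs g.1) = 1} = (Fintype.card F + 1) * (Fintype.card F - 1) ^ 2 := by
  have h := card_mul_eq_card_mul (fun (g : NC) (s : F) => eigs g.1 = {s})
    (s := {g : NC | #(eigs g.1) = 1}) (t := univ.erase 0) (m := 1) (n := Fintype.card F ^ 2 - 1)
    ?_ ?_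
  · rw [card_erase_of_mem (mem_univ _), card_univ, mul_one] at h
    rw [h, show Fintype.card F ^ 2 - 1 = _ from Nat.sq_sub_sq _ 1]
    ring
  · intro g hg
    obtain ⟨s, hs⟩ := card_eq_one.1 (mem_filter.1 hg).2
    rw [bipartiteAbove, card_eq_one]
    refine ⟨s, ?_⟩
    ext t
    simp only [hs, mem_filter, mem_erase, mem_univ, and_true, mem_singleton, singleton_inj]
    refine ⟨fun h => h.2.symm, fun h => ⟨?_, h.symm⟩⟩
    rintro rfl
    exact zero_notMem_eigs g.1 (by simp [hs, h])
  · intro s hs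
    rw [← card_noncentral_with_double_eigenvalue (mem_erase.1 hs).1, bipartiteBelow, filter_filter]
    congr 1
    ext g
    simp only [mem_filter, mem_univ, true_and, and_iff_right_iff_imp]
    intro h
    simp [h]

/-- Double counting against ordered pairs of distinct nonzero eigenvalues; each `g` has two such
orderings. -/
lemma two_mul_card_noncentral_of_card_eigs_eq_two :
    2 * #{g : NC | #(eigs g.1) = 2} =
      (Fintype.card F - 1) * (Fintype.card F - 2) * (Fintype.card F * (Fintype.card F + 1)) := by
  have h := card_mul_eq_card_mul (fun (g : NC) (p : F × F) => p ∈ (eigs g.1).offDiag)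
    (s := {g : NC | #(eigs g.1) = 2}) (t := (univ.erase 0).offDiag) (m := 2)
    (n := Fintype.card F * (Fintype.card F + 1)) ?_ ?_
  · rw [offDiag_card, card_erase_of_mem (mem_univ _), card_univ, mul_comm] at h
    rw [h, ← Nat.mul_sub_one]
    rfl
  · intro g hg
    have h2 := (mem_filter.1 hg).2
    have : bipartiteAbove (fun (g : NC) (p : F × F) => p ∈ (eigs g.1).offDiag)
        (univ.erase 0).offDiag g = (eigs g.1).offDiag := by
      rw [bipartiteAbove, filter_mem_eq_inter, inter_eq_right]
      refine offDiag_mono fun t ht => mem_erase.2 ⟨?_, mem_univ _⟩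
      rintro rfl
      exact zero_notMem_eigs g.1 ht
    rw [this, offDiag_card, h2]
  · rintro ⟨s, t⟩ hst
    obtain ⟨hs, ht, hst⟩ := mem_offDiag.1 hst
    rw [← card_noncentral_with_distinct_eigenvalues (mem_erase.1 hs).1 (mem_erase.1 ht).1 hst,
      bipartiteBelow, filter_filter]
    congr 1
    ext g
    simp only [mem_filter, mem_univ, true_and, mem_offDiag]
    refine ⟨fun h => ⟨h.2.1, h.2.2.1⟩, fun h => ⟨le_antisymm (card_eigs_le_two _) ?_, h.1, h.2, hst⟩⟩
    exact (card_pair hst).ge.trans (card_le_card (insert_subset h.1 (singleton_subset_iff.2 h.2)))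

lemma card_center_GL_two :
    Nat.card (Subgroup.center (GL (Fin 2) F)) = Fintype.card F - 1 := by
  have hinj : Function.Injective (GeneralLinearGroup.scalar (Fin 2) : Fˣ →* GL (Fin 2) F) := by
    intro u v h
    have h00 := congrArg (fun g : GL (Fin 2) F => g.1 0 0) h
    refine Units.ext ?_
    simpa [GeneralLinearGroup.scalar] using h00
  rw [GeneralLinearGroup.center_eq_range_scalar,
    ← Nat.card_congr (MonoidHom.ofInjective hinj).toEquiv, Nat.card_eq_fintype_card,
    Fintype.card_units]

lemma card_noncentral : Fintype.card NC + (Fintype.card F - 1) =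
    (Fintype.card F ^ 2 - 1) * (Fintype.card F ^ 2 - Fintype.card F) := by
  have hG := card_GL_field (𝔽 := F) 2
  rw [Fin.prod_univ_two] at hG
  simp only [Fin.val_zero, Fin.val_one, pow_zero, pow_one] at hG
  rw [← hG, ← card_center_GL_two, ← Nat.card_eq_fintype_card, add_comm]
  classical
  rw [← Nat.card_congr (Equiv.sumCompl fun g => g ∈ Subgroup.center (GL (Fin 2) F)), Nat.card_sum]

lemma card_noncentral_eq_sum : Fintype.card NC = #{g : NC | #(eigs g.1) = 0} +
    #{g : NC | #(eigs g.1) = 1} + #{g : NC | #(eigs g.1) = 2} := by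
  rw [← card_univ, card_eq_sum_card_fiberwise (f := fun g : NC => #(eigs g.1)) (t := range 3)
    fun g _ => by simpa using Nat.lt_succ_of_le (card_eigs_le_two g.1)]
  simp [sum_range_succ]

/-- The elements without eigenvalues are what remains of the total. The factors q - k, including `-
0`, match `card_commSetoid_class`. -/
theorem card_noncentral_of_card_eigs (hF : 2 < Fintype.card F) :
    #{g : NC | #(eigs g.1) = 0} = Fintype.card F * (Fintype.card F - 1) / 2 *
        ((Fintype.card F - 1) * (Fintype.card F - 0)) ∧
    #{g : NC | #(eigs g.1) = 1} = (Fintype.card F + 1) *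
        ((Fintype.card F - 1) * (Fintype.card F - 1)) ∧
    #{g : NC | #(eigs g.1) = 2} = Fintype.card F * (Fintype.card F + 1) / 2 *
        ((Fintype.card F - 1) * (Fintype.card F - 2)) := by
  have h1 := card_noncentral_of_card_eigs_eq_one (F := F)
  have h2 := two_mul_card_noncentral_of_card_eigs_eq_two (F := F)
  have h3 := card_noncentral (F := F)
  rw [card_noncentral_eq_sum] at h3
  have l0 := two_mul_half_mul_pred (Fintype.card F)
  have l2 := two_mul_half_mul_succ (Fintype.card F)
  generalize #{g : NC | #(eigs g.1) = 0} = N0 at *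
  generalize #{g : NC | #(eigs g.1) = 1} = N1 at *
  generalize #{g : NC | #(eigs g.1) = 2} = N2 at *
  generalize Fintype.card F * (Fintype.card F - 1) / 2 = L0 at *
  generalize Fintype.card F * (Fintype.card F + 1) / 2 = L2 at *
  generalize Fintype.card F = q at *
  -- Writing q = n + 2 removes the truncated subtractions before passing to ℤ.
  obtain ⟨n, rfl⟩ : ∃ n, q = n + 2 := ⟨q - 2, by omega⟩
  have e1 : n + 2 - 1 = n + 1 := rfl
  have e2 : (n + 2) ^ 2 - 1 = (n + 1) * (n + 3) := by
    rw [show (n + 2) ^ 2 = (n + 1) * (n + 3) + 1 by ring, Nat.add_sub_cancel]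
  have e3 : (n + 2) ^ 2 - (n + 2) = (n + 1) * (n + 2) := by
    rw [show (n + 2) ^ 2 = (n + 1) * (n + 2) + (n + 2) by ring, Nat.add_sub_cancel]
  rw [e2, e3, e1] at h3
  rw [e1] at h1 h2 ⊢
  rw [Nat.add_sub_cancel] at h2 ⊢
  rw [Nat.sub_zero]
  zify at h1 h2 h3 l0 l2 ⊢
  refine ⟨?_, by linear_combination h1, ?_⟩
  · have : 2 * (N0 : ℤ) = 2 * (L0 * ((n + 1) * (n + 2))) := by
      linear_combination 2 * h3 - 2 * h1 - h2 - ((n : ℤ) + 1) * (n + 2) * l0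
    linarith
  · have : 2 * (N2 : ℤ) = 2 * (L2 * ((n + 1) * n)) := by
      linear_combination h2 - ((n : ℤ) + 1) * n * l2
    linarith

theorem commutingGraph_GL_two_iso (hF : 2 < Fintype.card F) :
    Nonempty (commutingGraph (GL (Fin 2) F) ≃g
      (completeCopies (Fintype.card F * (Fintype.card F + 1) / 2)
          ((Fintype.card F - 1) * (Fintype.card F - 2)) ⊕g
        completeCopies (Fintype.card F * (Fintype.card F - 1) / 2)
          ((Fintype.card F - 1) * (Fintype.card F - 0)) ⊕g
        completeCopies (Fintype.card F + 1) ((Fintype.card F - 1) * (Fintype.card F - 1)))) := by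
  obtain ⟨h0, h1, h2⟩ := card_noncentral_of_card_eigs hF
  refine iso_of_classes _ (commSetoid F) (fun _ _ => Iff.rfl) (fun g => #(eigs g.1))
    (fun g => card_eigs_le_two g.1) (fun g h => card_eigs_eq_of_comm hF g h)
    (fun k => if k = 0 then Fintype.card F * (Fintype.card F - 1) / 2 else
      if k = 1 then Fintype.card F + 1 else Fintype.card F * (Fintype.card F + 1) / 2)
    (fun k => (Fintype.card F - 1) * (Fintype.card F - k)) ?_ card_commSetoid_class ?_
  · intro k hk
    exact Nat.mul_pos (by omega) (by omega)
  · intro k hk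
    rw [Nat.card_eq_fintype_card, Fintype.card_subtype]
    interval_cases k
    · exact h0
    · exact h1
    · exact h2

end Counting

end CommonNeighborhood

theorem mainTheorem5 (q : ℕ) (hq : 2 < q) (F : Type*) [Field F] [Fintype F] [DecidableEq F]
    (hF : Fintype.card F = q) :
    Nonempty (commutingGraph (Matrix.GeneralLinearGroup (Fin 2) F) ≃g
      (completeCopies (q * (q + 1) / 2) (q ^ 2 - 3 * q + 2) ⊕g
        completeCopies (q * (q - 1) / 2) (q ^ 2 - q) ⊕g
        completeCopies (q + 1) (q ^ 2 - 2 * q + 1))) ∧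
    cnlSpec (commutingGraph (Matrix.GeneralLinearGroup (Fin 2) F)) =
      Multiset.replicate (q ^ 2 + q + 1) (0 : ℝ) +
      Multiset.replicate ((q ^ 2 + q) * (q ^ 2 - 3 * q + 1) / 2)
        (((q : ℝ) ^ 2 - 3 * q + 2) * ((q : ℝ) ^ 2 - 3 * q)) +
      Multiset.replicate ((q ^ 2 - q) * (q ^ 2 - q - 1) / 2)
        (((q : ℝ) ^ 2 - q) * ((q : ℝ) ^ 2 - q - 2)) +
      Multiset.replicate ((q + 1) * (q ^ 2 - 2 * q))
        (((q : ℝ) ^ 2 - 2 * q + 1) * ((q : ℝ) ^ 2 - 2 * q - 1)) ∧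
    cnslSpec (commutingGraph (Matrix.GeneralLinearGroup (Fin 2) F)) =
      Multiset.replicate ((q ^ 2 + q) / 2)
        (2 * ((q : ℝ) ^ 2 - 3 * q + 1) * ((q : ℝ) ^ 2 - 3 * q)) +
      Multiset.replicate ((q ^ 2 + q) * (q ^ 2 - 3 * q + 1) / 2)
        (((q : ℝ) ^ 2 - 3 * q) ^ 2) +
      Multiset.replicate ((q ^ 2 - q) / 2)
        (2 * ((q : ℝ) ^ 2 - q - 1) * ((q : ℝ) ^ 2 - q - 2)) +
      Multiset.replicate ((q ^ 2 - q) * (q ^ 2 - q - 1) / 2)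
        (((q : ℝ) ^ 2 - q - 2) ^ 2) +
      Multiset.replicate (q + 1)
        (2 * ((q : ℝ) ^ 2 - 2 * q) * ((q : ℝ) ^ 2 - 2 * q - 1)) +
      Multiset.replicate ((q + 1) * (q ^ 2 - 2 * q))
        (((q : ℝ) ^ 2 - 2 * q - 1) ^ 2) ∧
    cnlEnergy (commutingGraph (Matrix.GeneralLinearGroup (Fin 2) F)) =
      ((q : ℝ) - 2) * (q - 1) * q ^ 4 * (q + 1) * (2 * q - 3) * ((q - 1) * q - 1) /
        ((q : ℝ) ^ 3 - q - 1) ∧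
    (q ≤ 5 → cnslEnergy (commutingGraph (Matrix.GeneralLinearGroup (Fin 2) F)) =
      ((q : ℝ) - 2) * q * (q + 1) *
          (q * (q * (q * (q * (2 * q * ((q - 4) * q + 6) - 7) - 7) - 1) + 11) + 2) /
        ((q : ℝ) ^ 3 - q - 1)) ∧
    (6 ≤ q → cnslEnergy (commutingGraph (Matrix.GeneralLinearGroup (Fin 2) F)) =
      (q : ℝ) * (q + 1) *
          ((q * (q * (q * (q * (2 * q - 11) + 20) - 16) + 7) + 8) * q ^ 3 - 12 * q - 4) /
        ((q : ℝ) ^ 3 - q - 1)) := by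
  -- The three clique sizes are brought to the uniform shape (q - 1)(q - k).
  have h2 : q ^ 2 - 3 * q + 2 = (q - 1) * (q - 2) := by
    have h := split_size_add hq
    obtain ⟨n, rfl⟩ : ∃ n, q = n + 2 := ⟨q - 2, by omega⟩
    rw [show n + 2 - 1 = n + 1 from rfl, Nat.add_sub_cancel]
    linarith
  have h0 : q ^ 2 - q = (q - 1) * (q - 0) := by
    rw [Nat.sub_zero, Nat.sub_mul, one_mul, sq]
  have h1 : q ^ 2 - 2 * q + 1 = (q - 1) * (q - 1) := by
    have h := double_size_add hq
    obtain ⟨n, rfl⟩ : ∃ n, q = n + 2 := ⟨q - 2, by omega⟩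
    rw [show n + 2 - 1 = n + 1 from rfl]
    linarith
  have hiso : Nonempty (commutingGraph (Matrix.GeneralLinearGroup (Fin 2) F) ≃g
      (completeCopies (q * (q + 1) / 2) (q ^ 2 - 3 * q + 2) ⊕g
        completeCopies (q * (q - 1) / 2) (q ^ 2 - q) ⊕g
        completeCopies (q + 1) (q ^ 2 - 2 * q + 1))) := by
    rw [h2, h0, h1]
    subst hF
    exact commutingGraph_GL_two_iso hq
  obtain ⟨e⟩ := hiso
  exact ⟨⟨e⟩, cnlSpec_of_GL_iso hq e, cnslSpec_of_GL_iso hq e, cnlEnergy_of_GL_iso hq e,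
    fun h => cnslEnergy_of_GL_iso_of_le hq h e, fun h => cnslEnergy_of_GL_iso_of_ge h e⟩
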